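/- **Setting.** Let $q>0$, $q\neq 1$, $h=\log q$, and $[z]_q=\dfrac{q^{z/2}-q^{-z/2}}{q^{1/2}-q^{-1/2}}$ for $z\in\mathbb C$. The algebra ${\rm so}'_q(r,s)$, $r,s>2$, is generated by $I_{i,i-1}$, $2\le i\le r+s$, with the relations $I_{i,i-1}I_{i+1,i}^2-aI_{i+1,i}I_{i,i-1}I_{i+1,i}+I_{i+1,i}^2I_{i,i-1}=-I_{i,i-1}$, $I_{i,i-1}^2I_{i+1,i}-aI_{i,i-1}I_{i+1,i}I_{i,i-1}+I_{i+1,i}I_{i,i-1}^2=-I_{i+1,i}$, where $a=q^{1/2}+q^{-1/2}$, and $[I_{i,i-1},I_{j,j-1}]=0$ for $|i-j|>1$. For $n\ge 3$ a *pattern* of size $n$ is a sequence of integers $|m_n,m_{n-1},\dots,m_2\rangle$ with $m_n\ge m_{n-1}\ge\dots\ge m_3\ge|m_2|$. On patterns of size $n$ (with a sequence that is not a pattern denoting the zero vector) the generators $J_2,\dots,J_n$ of ${\rm so}'_q(n)$ act as follows; only the altered entry is displayed on the right. - $J_2$ multiplies the vector by ${\rm i}[m_2]_q$. - With $l=m_3$,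 $m=m_2$ and $d(m)=\big((q^{m/2}+q^{-m/2})(q^{(m+1)/2}+q^{-(m+1)/2})\big)^{-1/2}$, $J_3$ sends the vector to $d(m)([l-m]_q[l+m+1]_q)^{1/2}|m+1\rangle-d(m-1)([l+m]_q[l-m+1]_q)^{1/2}|m-1\rangle$. - For $4\le i\le n$, with $b=m_{i-1}$, $c=m_{i-2}$ and $R_i(b,c)=\left(\dfrac{[b+c+i-3]_q[b-c+1]_q}{[2b+i-3]_q[2b+i-1]_q}\right)^{1/2}$, $J_i$ sends the vector to $([m_i+b+i-2]_q[m_i-b]_q)^{1/2}R_i(b,c)|b+1\rangle-([m_i+b+i-3]_q[m_i-b+1]_q)^{1/2}R_i(b-1,c)|b-1\rangle$. Let $\epsilon\in\{0,1\}$ and $\lambda\in\mathbb C$. The *degenerate principal series representation* $T_{\epsilon\lambda}$ acts in the Hilbert space $\mathcal H$ with orthonormal basis $|m,k,\dots;m',k',\dots\rangle$ indexed by the pairs of a pattern $(m,k,\dots)$ of size $r$ and a pattern $(m',k',\dots)$ of size $s$ with $m+m'\equiv\epsilon\pmod 2$; its operators are defined on the linear span $\mathcal W$ of the basis. $T_{\epsilon\lambda}(I_{i,i-1})$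 acts as $J_i$ on the first pattern for $2\le i\le r$, and as $J_{r+s+2-i}$ on the second pattern for $r+2\le i\le r+s$; and $$\begin{aligned}T_{\epsilon\lambda}(I_{r+1,r})|m,k,\dots;m',k',\dots\rangle={}&K_mL_{m'}[\lambda+m+m']_q\,|m+1,k,\dots;m'+1,k',\dots\rangle\\&-K_mL_{m'-1}[\lambda+m-m'-s+2]_q\,|m+1,k,\dots;m'-1,k',\dots\rangle\\&+K_{m-1}L_{m'}[\lambda-m+m'-r+2]_q\,|m-1,k,\dots;m'+1,k',\dots\rangle\\&-K_{m-1}L_{m'-1}[\lambda-m-m'-r-s+4]_q\,|m-1,k,\dots;m'-1,k',\dots\rangle,\end{aligned}$$ $$K_m=\left(\frac{[m-k+1]_q[m+k+r-2]_q}{[2m+r]_q[2m+r-2]_q}\right)^{1/2},\qquad L_{m'}=\left(\frac{[m'-k'+1]_q[m'+k'+s-2]_q}{[2m'+s]_q[2m'+s-2]_q}\right)^{1/2}.$$ (A vector whose label is not such a pair of patterns is zero.) $T_{\epsilon\lambda}$ is called *irreducible* if every nonzero subspace of $\mathcal W$ that is invariant under the operators of the representation is dense in $\mathcal H$. Since replacing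 $\lambda$ by $\lambda+2\pi{\rm i}/h$ gives an equivalent representation, it is assumed that $0\le{\rm Im}\,\lambda<2\pi/|h|$. **Theorem 1.** Let $r,s>2$, $\epsilon\in\{0,1\}$, and $\lambda\in\mathbb C$ with $0\le{\rm Im}\,\lambda<2\pi/|h|$. - If $r$ and $s$ are both even, then $T_{\epsilon\lambda}$ is irreducible if and only if $\lambda$ is not an integer with $\lambda\equiv\epsilon\pmod 2$. - If one of $r$, $s$ is even and the other is odd, then $T_{\epsilon\lambda}$ is irreducible if and only if $\lambda$ is not an integer. - If $r$ and $s$ are both odd, then $T_{\epsilon\lambda}$ is irreducible if and only if either $\lambda$ is not an integer, or $\lambda$ is an integer with $\lambda\equiv\epsilon\pmod 2$ and $0<\lambda<r+s-2$. -/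

import Mathlib

open Complex

namespace DegenerateSeries

noncomputable section

/-- The `q`-number `[z]_q = (q^{z/2} - q^{-z/2}) / (q^{1/2} - q^{-1/2})` of a complex number `z`
(meaningful for `q > 0`, `q ≠ 1`). -/
def qnum (q : ℝ) (z : ℂ) : ℂ :=
  ((q : ℂ) ^ (z / 2) - (q : ℂ) ^ (-z / 2)) / ((q : ℂ) ^ ((1 : ℂ) / 2) - (q : ℂ) ^ (-(1 : ℂ) / 2))

/-- The `q`-number `[x]_q` of a real number `x`, as a real number. -/
def qnumR (q x : ℝ) : ℝ :=
  (q ^ (x / 2) - q ^ (-x / 2)) / (q ^ ((1 : ℝ) / 2) - q ^ (-(1 : ℝ) / 2))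

/-! ### Class 1 representations of the compact algebra in Gel'fand--Tsetlin form -/

/-- `p` is the pattern `|m_n, m_{n-1}, …, m_3, m_2⟩` of a class 1 representation of `so'_q(n)`,
`n ≥ 3`: the entry `m_j` is `p j` for `2 ≤ j ≤ n`, one has `m_n ≥ ⋯ ≥ m_3 ≥ |m_2|`, and
`p j = 0` at the places `j` that carry no entry. -/
def IsPattern (n : ℕ) (p : ℕ → ℤ) : Prop :=
  (∀ j, j < 2 ∨ n < j → p j = 0) ∧ |p 2| ≤ p 3 ∧ ∀ j, 3 ≤ j → j < n → p j ≤ p (j + 1)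

/-- The pattern obtained from `p` by adding `x` to the entry `m_j`. -/
def shift (p : ℕ → ℤ) (j : ℕ) (x : ℤ) : ℕ → ℤ := Function.update p j (p j + x)

/-- `d(m) = ([m]_q [m+1]_q / ([2m]_q [2m+2]_q))^{1/2}`. Since
`[m]_q / [2m]_q = 1 / (q^{m/2} + q^{-m/2})`, this is written in the form which also makes sense
(by continuity) at `m = 0` and `m = -1`. -/
def dCoef (q : ℝ) (m : ℝ) : ℝ :=
  Real.sqrt (1 / ((q ^ (m / 2) + q ^ (-m / 2)) * (q ^ ((m + 1) / 2) + q ^ (-(m + 1) / 2))))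

/-- `R(b) = ([b+c+n-3]_q [b-c+1]_q / ([2b+n-3]_q [2b+n-1]_q))^{1/2}`, where
`b = m_{n-1}`, `c = m_{n-2}`. -/
def RCoef (q : ℝ) (n : ℕ) (b c : ℝ) : ℝ :=
  Real.sqrt (qnumR q (b + c + n - 3) * qnumR q (b - c + 1) /
    (qnumR q (2 * b + n - 3) * qnumR q (2 * b + n - 1)))

/-- The action of the generator `I_{i,i-1}` (`i ≥ 2`) of the compact algebra on the basis vector
with pattern `p`. The basis vector with pattern `p'` is `ket p'` (zero if `p'` is not a pattern).
For `i = 3` the numbers `l = p 3`, `m = p 2` are the labels of the representation `T_l` of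
`so'_q(3)` and of its basis vector `|m⟩`. -/
def compactAction {V : Type*} [AddCommGroup V] [Module ℂ V] (q : ℝ) (i : ℕ)
    (ket : (ℕ → ℤ) → V) (p : ℕ → ℤ) : V :=
  if i = 2 then
    (I * qnum q (p 2 : ℂ)) • ket p
  else if i = 3 then
    ((dCoef q (p 2) * Real.sqrt (qnumR q (p 3 - p 2) * qnumR q (p 3 + p 2 + 1)) : ℝ) : ℂ) •
        ket (shift p 2 1)
      - ((dCoef q (p 2 - 1) * Real.sqrt (qnumR q (p 3 + p 2) * qnumR q (p 3 - p 2 + 1)) : ℝ) : ℂ) •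
        ket (shift p 2 (-1))
  else
    ((Real.sqrt (qnumR q (p i + p (i - 1) + i - 2) * qnumR q (p i - p (i - 1))) *
        RCoef q i (p (i - 1)) (p (i - 2)) : ℝ) : ℂ) • ket (shift p (i - 1) 1)
      - ((Real.sqrt (qnumR q (p i + p (i - 1) + i - 3) * qnumR q (p i - p (i - 1) + 1)) *
        RCoef q i (p (i - 1) - 1) (p (i - 2)) : ℝ) : ℂ) • ket (shift p (i - 1) (-1))

/-! ### The degenerate principal series of `so'_q(r,s)` -/

/-- `P = |m, k, j, … ; m', k', j', …⟩` is a double pattern with `m + m' ≡ ε (mod 2)`. -/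
def IsDoublePattern (r s : ℕ) (ε : ℤ) (P : (ℕ → ℤ) × (ℕ → ℤ)) : Prop :=
  IsPattern r P.1 ∧ IsPattern s P.2 ∧ P.1 r + P.2 s ≡ ε [ZMOD 2]

/-- The index set of the orthonormal basis of the space of `T_{ελ}`. -/
abbrev DoublePattern (r s : ℕ) (ε : ℤ) : Type :=
  {P : (ℕ → ℤ) × (ℕ → ℤ) // IsDoublePattern r s ε P}

/-- The algebraic span of the basis vectors: the common domain of the operators of `T_{ελ}`. -/
abbrev Domain (r s : ℕ) (ε : ℤ) : Type := DoublePattern r s ε →₀ ℂ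

/-- The Hilbert space of `T_{ελ}`, with orthonormal basis indexed by the double patterns. -/
abbrev HilbertSp (r s : ℕ) (ε : ℤ) : Type := lp (fun _ : DoublePattern r s ε => ℂ) 2

open Classical in
/-- The inclusion of the domain as a dense subspace of the Hilbert space: the basis vector with
label `P` goes to the `P`-th vector of the standard orthonormal basis. -/
def toHilbert (r s : ℕ) (ε : ℤ) : Domain r s ε →ₗ[ℂ] HilbertSp r s ε :=
  Finsupp.linearCombination ℂ
    (fun P => (lp.single 2 P (1 : ℂ) : lp (fun _ : DoublePattern r s ε => ℂ) 2))

open Classical in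
/-- The basis vector with label `P`; it is zero if `P` is not one of the labels. -/
def ket (r s : ℕ) (ε : ℤ) (P : (ℕ → ℤ) × (ℕ → ℤ)) : Domain r s ε :=
  if h : IsDoublePattern r s ε P then Finsupp.single ⟨P, h⟩ 1 else 0

/-- `K_m = ([m-k+1]_q [m+k+r-2]_q / ([2m+r]_q [2m+r-2]_q))^{1/2}`. The coefficient `L_{m'}` is the
same expression in `m'`, `k'`, `s`. -/
def KCoef (q : ℝ) (r : ℕ) (m k : ℝ) : ℝ :=
  Real.sqrt (qnumR q (m - k + 1) * qnumR q (m + k + r - 2) /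
    (qnumR q (2 * m + r) * qnumR q (2 * m + r - 2)))

/-- The action of the noncompact generator `I_{r+1,r}` on the basis vector with label `P`. -/
def noncompactAction (q : ℝ) (r s : ℕ) (ε : ℤ) (lam : ℂ) (P : (ℕ → ℤ) × (ℕ → ℤ)) :
    Domain r s ε :=
  let m : ℤ := P.1 r
  let k : ℤ := P.1 (r - 1)
  let m' : ℤ := P.2 s
  let k' : ℤ := P.2 (s - 1)
  (((KCoef q r m k * KCoef q s m' k' : ℝ) : ℂ) * qnum q (lam + m + m')) •
      ket r s ε (shift P.1 r 1, shift P.2 s 1)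
  - (((KCoef q r m k * KCoef q s (m' - 1) k' : ℝ) : ℂ) * qnum q (lam + m - m' - s + 2)) •
      ket r s ε (shift P.1 r 1, shift P.2 s (-1))
  + (((KCoef q r (m - 1) k * KCoef q s m' k' : ℝ) : ℂ) * qnum q (lam - m + m' - r + 2)) •
      ket r s ε (shift P.1 r (-1), shift P.2 s 1)
  - (((KCoef q r (m - 1) k * KCoef q s (m' - 1) k' : ℝ) : ℂ) *
        qnum q (lam - m - m' - r - s + 4)) •
      ket r s ε (shift P.1 r (-1), shift P.2 s (-1))

/-- The operator `T_{ελ}(I_{i,i-1})`, `2 ≤ i ≤ r + s`, on the domain.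

For `i ≤ r` it acts on the first pattern, for `i ≥ r + 2` on the second one. The second pattern
belongs to the chain of subalgebras of `so'_q(s)` in which `so'_q(s-1)` is generated by the
`I_{i,i-1}` with `i ≥ r + 3`, which are those that commute with `I_{r+1,r}`; hence `I_{i,i-1}` acts
as the generator of `so'_q(s)` with number `r + s + 2 - i`. -/
def op (q : ℝ) (r s : ℕ) (ε : ℤ) (lam : ℂ) (i : ℕ) : Module.End ℂ (Domain r s ε) :=
  Finsupp.linearCombination ℂ (fun P : DoublePattern r s ε =>
    if i ≤ r then
      compactAction q i (fun p => ket r s ε (p, P.1.2)) P.1.1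
    else if i = r + 1 then
      noncompactAction q r s ε lam P.1
    else
      compactAction q (r + s + 2 - i) (fun p => ket r s ε (P.1.1, p)) P.1.2)

/-- The algebra `T_{ελ}(so'_q(r,s))` of all operators of the representation: the algebra of
operators on the domain generated by the operators `T_{ελ}(I_{i,i-1})`, `2 ≤ i ≤ r + s`. -/
def operatorAlgebra (q : ℝ) (r s : ℕ) (ε : ℤ) (lam : ℂ) :
    Subalgebra ℂ (Module.End ℂ (Domain r s ε)) :=
  Algebra.adjoin ℂ (op q r s ε lam '' Set.Icc 2 (r + s))

/-- `T_{ελ}` is irreducible: every nonzero invariant subspace (of the common domain of the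
operators) has the whole Hilbert space as its closure. -/
def IsIrreducible (q : ℝ) (r s : ℕ) (ε : ℤ) (lam : ℂ) : Prop :=
  ∀ S : Submodule ℂ (Domain r s ε),
    (∀ A ∈ operatorAlgebra q r s ε lam, ∀ v ∈ S, A v ∈ S) →
      S ≠ ⊥ → closure (toHilbert r s ε '' (S : Set (Domain r s ε))) = Set.univ

end

end DegenerateSeries

/-! Let S be an invariant subspace. The compact generators alone force S to be spanned by basis
vectors. The lowest one is diagonal with eigenvalues i[m_2]_q, which are distinct. Once m_2, …, m_i
are isolated, raising m_i and lowering it back gives a diagonal operator whose eigenvalue is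
strictly monotone in m_{i+1} (`upCoef_sq_inj`, `Side.separates_pt`). Raising and lowering elements
between patterns with the same top entry do not vanish, so S is described by a set of pairs (m, m')
of top entries (`single_mem_iff_ket_topPattern`).

The noncompact generator sends (m, m') to its four diagonal neighbours. The factors K and L are
nonzero on admissible moves, so only a vanishing q-number blocks a move. If nothing is blocked, the
parity class is connected and S is everything (`isIrreducible_of_qnum_ne_zero`). If a kind of move
is blocked somewhere, it is blocked along a whole line m + m' = const or m - m' = const, and the
labels on one side of that line span a non-dense invariant subspace (`not_isIrreducible`).

In the strip allowed for Im λ, [z]_q vanishes only at z = 0. Hence blocking requires an integer λ,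
and the four kinds of moves give four conditions on its parity and size (`isIrreducible_iff`); the
theorem sorts them by the parities of r and s. -/

namespace DegenerateSeries

noncomputable section

/-! ### Subspaces closed under filtering -/

section Separation

variable {X : Type*}

open Classical in
/-- The projection of finitely supported functions onto those supported where `p` holds. -/
def filterMap (p : X → Prop) : Module.End ℂ (X →₀ ℂ) where
  toFun v := v.filter p
  map_add' _ _ := Finsupp.filter_add
  map_smul' _ _ := by ext x; simp [Finsupp.filter_apply]

open Classical in
theorem filterMap_apply (p : X → Prop) (v : X →₀ ℂ) (x : X) :
    filterMap p v x = if p x then v x else 0 := Finsupp.filter_apply _ _ _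

theorem filterMap_single_pos {p : X → Prop} {x : X} (h : p x) (c : ℂ) :
    filterMap p (Finsupp.single x c) = Finsupp.single x c := by
  classical exact Finsupp.filter_single_of_pos p h

theorem filterMap_single_neg {p : X → Prop} {x : X} (h : ¬ p x) (c : ℂ) :
    filterMap p (Finsupp.single x c) = 0 := by
  classical exact Finsupp.filter_single_of_neg p h

/-- `S` is closed under the projections onto the fibres of `g`. -/
def Separates {α : Type*} (S : Submodule ℂ (X →₀ ℂ)) (g : X → α) : Prop :=
  ∀ v ∈ S, ∀ a, filterMap (fun x => g x = a) v ∈ S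

theorem apply_eq_mul_of_diagonal (D : Module.End ℂ (X →₀ ℂ)) (f : X → ℂ) (w : X →₀ ℂ)
    (hD : ∀ x ∈ w.support, D (Finsupp.single x 1) = f x • Finsupp.single x 1) (y : X) :
    D w y = f y * w y := by
  classical
  conv_lhs => rw [← Finsupp.sum_single w]
  rw [Finsupp.sum, map_sum, Finsupp.finsetSum_apply, Finset.sum_eq_single y]
  · by_cases hy : y ∈ w.support
    · have : Finsupp.single y (w y) = w y • Finsupp.single y (1 : ℂ) := by simp
      rw [this, map_smul, hD y hy]
      simp [mul_comm]
    · simp [Finsupp.notMem_support_iff.1 hy]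
  · intro x hx hxy
    have : Finsupp.single x (w x) = w x • Finsupp.single x (1 : ℂ) := by simp
    rw [this, map_smul, hD x hx]
    simp [hxy]
  · intro hy
    simp [Finsupp.notMem_support_iff.1 hy]

/-- Induction on the size of the support: `D - f x₀` kills the coordinate `x₀`, and after division
by `a - f x₀` it is the identity on the fibre `f = a`. Diagonality is required only on the support
of `w`, because the operators used later are diagonal only on one fibre. -/
theorem filterMap_mem_of_diagonal {S : Submodule ℂ (X →₀ ℂ)} (D : Module.End ℂ (X →₀ ℂ))
    (hDS : ∀ v ∈ S, D v ∈ S) (f : X → ℂ) (a : ℂ) :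
    ∀ n : ℕ, ∀ w ∈ S, w.support.card = n →
      (∀ x ∈ w.support, D (Finsupp.single x 1) = f x • Finsupp.single x 1) →
      filterMap (fun x => f x = a) w ∈ S := by
  classical
  intro n
  induction n using Nat.strong_induction_on with
  | _ n ih =>
    intro w hw hn hD
    by_cases hall : ∀ x ∈ w.support, f x = a
    · have : filterMap (fun x => f x = a) w = w := by
        ext x
        rw [filterMap_apply]
        split_ifs with h
        · rfl
        · by_contra h0
          exact h (hall x (Finsupp.mem_support_iff.2 (Ne.symm h0)))
      rwa [this]
    · push Not at hall
      obtain ⟨x₀, hx₀, hne⟩ := hall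
      set w' : X →₀ ℂ := (a - f x₀)⁻¹ • (D w - f x₀ • w) with hw'
      have hsub : a - f x₀ ≠ 0 := sub_ne_zero.2 (Ne.symm hne)
      have hval : ∀ y, w' y = (a - f x₀)⁻¹ * ((f y - f x₀) * w y) := by
        intro y
        simp only [hw', Finsupp.smul_apply, Finsupp.sub_apply, smul_eq_mul,
          apply_eq_mul_of_diagonal D f w hD y]
        ring
      have hw'S : w' ∈ S := S.smul_mem _ (S.sub_mem (hDS w hw) (S.smul_mem _ hw))
      have hss : w'.support ⊆ w.support := by
        intro y hy
        rw [Finsupp.mem_support_iff, hval] at hy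
        rw [Finsupp.mem_support_iff]
        intro h0
        simp [h0] at hy
      have hcard : w'.support.card < n := by
        rw [← hn]
        refine Finset.card_lt_card ⟨hss, fun h => ?_⟩
        have := h hx₀
        rw [Finsupp.mem_support_iff, hval] at this
        simp at this
      have := ih _ hcard w' hw'S rfl (fun x hx => hD x (hss hx))
      convert this using 1
      ext y
      rw [filterMap_apply, filterMap_apply]
      split_ifs with h
      · rw [hval, h]
        field_simp
      · rfl

/-- If the fibres of `g` are separated and `f` is, on every fibre, the eigenvalue of a diagonal
operator preserving `S`, then the joint fibres of `g` and `f` are separated. -/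
theorem Separates.refine {α β : Type*} {S : Submodule ℂ (X →₀ ℂ)} {g : X → α}
    (hg : Separates S g) (f : X → ℂ)
    (hD : ∀ t, ∃ D : Module.End ℂ (X →₀ ℂ), (∀ v ∈ S, D v ∈ S) ∧
      ∀ x, g x = t → D (Finsupp.single x 1) = f x • Finsupp.single x 1)
    (h : X → β) (hh : ∀ x y, h x = h y ↔ g x = g y ∧ f x = f y) : Separates S h := by
  classical
  intro v hv a
  by_cases hx : ∃ x₀, h x₀ = a
  · obtain ⟨x₀, rfl⟩ := hx
    obtain ⟨D, hDS, hDx⟩ := hD (g x₀)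
    have := filterMap_mem_of_diagonal D hDS f (f x₀) _ _ (hg v hv (g x₀)) rfl (by
      intro x hx
      apply hDx
      rw [Finsupp.mem_support_iff, filterMap_apply] at hx
      by_contra hc
      simp [hc] at hx)
    convert this using 1
    ext y
    simp only [filterMap_apply, hh]
    by_cases h1 : g y = g x₀ <;> by_cases h2 : f y = f x₀ <;> simp [h1, h2]
  · convert S.zero_mem
    ext y
    rw [filterMap_apply, if_neg (fun hy => hx ⟨y, hy⟩)]
    rfl

/-- Two successive projections isolate one coordinate when `g` and `h` jointly determine the label.
-/
theorem single_mem_of_separates {α β : Type*} {S : Submodule ℂ (X →₀ ℂ)} {g : X → α} {h : X → β}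
    (hg : Separates S g) (hh : Separates S h)
    (hinj : ∀ x y, g x = g y → h x = h y → x = y) {v : X →₀ ℂ} (hv : v ∈ S) {x : X}
    (hx : v x ≠ 0) : Finsupp.single x 1 ∈ S := by
  classical
  have := S.smul_mem (v x)⁻¹ (hh _ (hg v hv (g x)) (h x))
  convert this using 1
  ext y
  rw [Finsupp.smul_apply, filterMap_apply, filterMap_apply, Finsupp.single_apply]
  by_cases hxy : x = y
  · subst hxy
    simp [hx]
  · rw [if_neg hxy]
    split_ifs with h1 h2
    · exact absurd (hinj _ _ h2.symm h1.symm) hxy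
    · simp
    · simp

end Separation

/-! ### `q`-numbers -/

section QNumbers

variable {q : ℝ}

/-- Numerator and denominator both change sign with log q, so q < 1 and q > 1 behave alike. -/
theorem qnumR_eq_sinh (hq : 0 < q) (x : ℝ) :
    qnumR q x = Real.sinh (x * Real.log q / 2) / Real.sinh (Real.log q / 2) := by
  have h : ∀ y : ℝ, q ^ (y / 2) - q ^ (-y / 2) = 2 * Real.sinh (y * Real.log q / 2) := by
    intro y
    rw [Real.sinh_eq, Real.rpow_def_of_pos hq, Real.rpow_def_of_pos hq]
    ring_nf
  rw [qnumR, h, h, one_mul, mul_div_mul_left _ _ two_ne_zero]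

theorem qnumR_zero : qnumR q 0 = 0 := by simp [qnumR]

theorem qnumR_strictMono (hq : 0 < q) (hq1 : q ≠ 1) : StrictMono (qnumR q) := by
  intro x y hxy
  rw [qnumR_eq_sinh hq, qnumR_eq_sinh hq]
  rcases lt_or_gt_of_ne (Real.log_ne_zero_of_pos_of_ne_one hq hq1) with h | h
  · refine (div_lt_div_right_of_neg (Real.sinh_neg_iff.2 (by linarith))).2 ?_
    exact Real.sinh_strictMono (by nlinarith)
  · refine div_lt_div_of_pos_right ?_ (Real.sinh_pos_iff.2 (by linarith))
    exact Real.sinh_strictMono (by nlinarith)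

theorem qnumR_pos (hq : 0 < q) (hq1 : q ≠ 1) {x : ℝ} (hx : 0 < x) : 0 < qnumR q x := by
  simpa [qnumR_zero] using qnumR_strictMono hq hq1 hx

theorem qnumR_nonneg (hq : 0 < q) (hq1 : q ≠ 1) {x : ℝ} (hx : 0 ≤ x) : 0 ≤ qnumR q x := by
  simpa [qnumR_zero] using (qnumR_strictMono hq hq1).monotone hx

theorem qnum_ofReal (hq : 0 < q) (x : ℝ) : qnum q (x : ℂ) = (qnumR q x : ℝ) := by
  rw [qnum, qnumR]
  push_cast [Complex.ofReal_cpow hq.le]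
  rfl

theorem qnum_zero : qnum q 0 = 0 := by simp [qnum]

theorem rpow_half_sub_ne_zero (hq : 0 < q) (hq1 : q ≠ 1) :
    (q : ℂ) ^ ((1 : ℂ) / 2) - (q : ℂ) ^ (-(1 : ℂ) / 2) ≠ 0 := by
  intro h
  have h1 := qnum_ofReal hq 1
  rw [qnum] at h1
  push_cast at h1
  rw [h, div_zero] at h1
  exact (qnumR_pos hq hq1 one_pos).ne (by exact_mod_cast h1)

/-- The zeros of `[z]_q` are the integer multiples of the period `2πi / log q`. -/
theorem eq_zero_of_qnum_eq_zero (hq : 0 < q) (hq1 : q ≠ 1) {z : ℂ} (h0 : 0 ≤ z.im)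
    (h1 : z.im < 2 * Real.pi / |Real.log q|) (hz : qnum q z = 0) : z = 0 := by
  have hlog := Real.log_ne_zero_of_pos_of_ne_one hq hq1
  have hq0 : (q : ℂ) ≠ 0 := by exact_mod_cast hq.ne'
  rw [qnum, div_eq_zero_iff, or_iff_left (rpow_half_sub_ne_zero hq hq1), sub_eq_zero] at hz
  have hexp : Complex.exp (z * Real.log q) = 1 := by
    rw [Complex.cpow_def_of_ne_zero hq0, Complex.cpow_def_of_ne_zero hq0,
      ← Complex.ofReal_log hq.le] at hz
    calc Complex.exp (z * Real.log q)
        = Complex.exp (Real.log q * (z / 2)) * Complex.exp (-(Real.log q * (-z / 2))) := by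
          rw [← Complex.exp_add]; ring_nf
      _ = 1 := by rw [hz, ← Complex.exp_add]; simp
  obtain ⟨n, hn⟩ := Complex.exp_eq_one_iff.1 hexp
  have him : z.im * Real.log q = n * (2 * Real.pi) := by
    have := congrArg Complex.im hn
    simpa using this
  have hre : z.re * Real.log q = 0 := by
    have := congrArg Complex.re hn
    simpa using this
  have habs : z.im * |Real.log q| < 2 * Real.pi := (lt_div_iff₀ (abs_pos.2 hlog)).1 h1
  -- The strip is narrower than one period: |n|·2π = Im z·|log q| < 2π.
  have hn0 : n = 0 := by
    have h2 : |(n : ℝ)| * (2 * Real.pi) < 1 * (2 * Real.pi) := by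
      rw [one_mul]
      calc |(n : ℝ)| * (2 * Real.pi) = |(n : ℝ) * (2 * Real.pi)| := by
            rw [abs_mul, abs_of_pos Real.two_pi_pos]
        _ = z.im * |Real.log q| := by rw [← him, abs_mul, abs_of_nonneg h0]
        _ < _ := habs
    have h3 := lt_of_mul_lt_mul_right h2 Real.two_pi_pos.le
    have h4 : |n| < 1 := by exact_mod_cast h3
    exact Int.abs_lt_one_iff.1 h4
  apply Complex.ext
  · exact (mul_eq_zero.1 hre).resolve_right hlog
  · rw [hn0] at him
    simpa [hlog] using him

end QNumbers

/-! ### Patterns -/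

section Patterns

variable {n : ℕ} {p : ℕ → ℤ}

theorem shift_same (p : ℕ → ℤ) (j : ℕ) (x : ℤ) : shift p j x j = p j + x := by simp [shift]

theorem shift_of_ne (p : ℕ → ℤ) {i j : ℕ} (h : i ≠ j) (x : ℤ) : shift p j x i = p i := by
  simp [shift, h]

theorem shift_shift (p : ℕ → ℤ) (j : ℕ) (x y : ℤ) :
    shift (shift p j x) j y = shift p j (x + y) := by
  simp [shift, add_assoc]

theorem shift_zero (p : ℕ → ℤ) (j : ℕ) : shift p j 0 = p := by simp [shift]

theorem IsPattern.le_succ (hp : IsPattern n p) {j : ℕ} (h2 : 2 ≤ j) (hj : j < n) :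
    p j ≤ p (j + 1) := by
  rcases h2.eq_or_lt with rfl | h
  · exact (le_abs_self _).trans hp.2.1
  · exact hp.2.2 j h hj

theorem IsPattern.abs_entry_le (hp : IsPattern n p) {j : ℕ} (h3 : 3 ≤ j) (hj : j ≤ n) :
    |p 2| ≤ p j := by
  induction j, h3 using Nat.le_induction with
  | base => exact hp.2.1
  | succ k hk ih => exact (ih (by omega)).trans (hp.2.2 k hk (by omega))

theorem IsPattern.nonneg (hp : IsPattern n p) {j : ℕ} (h3 : 3 ≤ j) (hj : j ≤ n) : 0 ≤ p j :=
  (abs_nonneg _).trans (hp.abs_entry_le h3 hj)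

theorem IsPattern.neg_le (hp : IsPattern n p) {j : ℕ} (h2 : 2 ≤ j) (hj : j < n) :
    -p (j + 1) ≤ p j := by
  rcases h2.eq_or_lt with rfl | h
  · exact (abs_le.1 hp.2.1).1
  · have := hp.nonneg h hj.le
    have := hp.nonneg (j := j + 1) (by omega) hj
    omega

theorem IsPattern.le_top (hp : IsPattern n p) {j : ℕ} (h2 : 2 ≤ j) (hj : j ≤ n) : p j ≤ p n := by
  induction hj using Nat.decreasingInduction with
  | of_succ k hk ih => exact (hp.le_succ h2 hk).trans (ih (by omega))
  | self => exact le_rfl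

theorem IsPattern.shift_up (hp : IsPattern n p) {j : ℕ} (h2 : 2 ≤ j) (hj : j < n)
    (hlt : p j < p (j + 1)) : IsPattern n (shift p j 1) := by
  refine ⟨fun i hi => ?_, ?_, fun i h3 hi => ?_⟩
  · rw [shift_of_ne p (by omega)]
    exact hp.1 i hi
  · rcases h2.eq_or_lt with rfl | h
    · rw [shift_same, shift_of_ne p (by omega), abs_le]
      have := hp.neg_le le_rfl hj
      norm_num at this hlt ⊢
      omega
    · rw [shift_of_ne p (by omega)]
      refine hp.2.1.trans ?_
      by_cases h3 : 3 = j
      · rw [← h3, shift_same]; omega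
      · rw [shift_of_ne p h3]
  · have := hp.2.2 i h3 hi
    by_cases h : i = j
    · subst h
      rw [shift_same, shift_of_ne p (by omega)]
      omega
    · rw [shift_of_ne p h]
      by_cases h' : i + 1 = j
      · rw [h', shift_same, ← h']; omega
      · rwa [shift_of_ne p h']

/-- The pattern all of whose entries are `m`. -/
def constPattern (n : ℕ) (m : ℤ) : ℕ → ℤ := fun j => if 2 ≤ j ∧ j ≤ n then m else 0

/-- The pattern `|m, 0, …, 0⟩`. -/
def topPattern (n : ℕ) (m : ℤ) : ℕ → ℤ := fun j => if j = n then m else 0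

theorem isPattern_constPattern (hn : 2 < n) {m : ℤ} (hm : 0 ≤ m) :
    IsPattern n (constPattern n m) := by
  refine ⟨fun j hj => ?_, ?_, fun j h3 hj => ?_⟩
  · exact if_neg (by omega)
  · rw [constPattern, constPattern, if_pos (by omega), if_pos (by omega), abs_of_nonneg hm]
  · rw [constPattern, constPattern, if_pos (by omega), if_pos (by omega)]

theorem isPattern_topPattern (hn : 2 < n) {m : ℤ} (hm : 0 ≤ m) :
    IsPattern n (topPattern n m) := by
  refine ⟨fun j hj => ?_, ?_, fun j h3 hj => ?_⟩
  · exact if_neg (by omega)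
  · rw [topPattern, topPattern, if_neg (by omega), abs_zero]
    split_ifs <;> omega
  · rw [topPattern, topPattern, if_neg (by omega)]
    split_ifs <;> omega

theorem topPattern_top (n : ℕ) (m : ℤ) : topPattern n m n = m := if_pos rfl

theorem topPattern_pred (hn : 2 < n) (m : ℤ) : topPattern n m (n - 1) = 0 := if_neg (by omega)

theorem shift_topPattern (n : ℕ) (m x : ℤ) :
    shift (topPattern n m) n x = topPattern n (m + x) := by
  ext j
  by_cases h : j = n
  · subst h; rw [shift_same, topPattern_top, topPattern_top]
  · rw [shift_of_ne _ h, topPattern, topPattern, if_neg h, if_neg h]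

theorem IsPattern.eq_constPattern (hp : IsPattern n p)
    (h : ∀ j, 2 ≤ j → j < n → p (j + 1) ≤ p j) : p = constPattern n (p n) := by
  ext j
  by_cases hj : 2 ≤ j ∧ j ≤ n
  · rw [constPattern, if_pos hj]
    obtain ⟨h2, hj⟩ := hj
    induction hj using Nat.decreasingInduction with
    | of_succ k hk ih =>
      exact (le_antisymm (hp.le_succ h2 hk) (h k h2 hk)).trans (ih (by omega))
    | self => rfl
  · rw [constPattern, if_neg hj, hp.1 j (by omega)]

end Patterns

/-! ### Matrix elements of the compact generators -/

section Coefficients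

variable {q : ℝ} {n : ℕ} {p : ℕ → ℤ}

/-- The factor of the matrix element `upCoef` depending only on the entries below `m_i`. -/
def leadCoef (q : ℝ) (i : ℕ) (p : ℕ → ℤ) : ℝ :=
  if i = 3 then dCoef q (p 2) else RCoef q i (p (i - 1)) (p (i - 2))

/-- The matrix element of `I_{i,i-1}`, `i ≥ 3`, raising the entry `m_{i-1}`. -/
def upCoef (q : ℝ) (i : ℕ) (p : ℕ → ℤ) : ℝ :=
  leadCoef q i p *
    Real.sqrt (qnumR q (p i + p (i - 1) + i - 2) * qnumR q (p i - p (i - 1)))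

theorem compactAction_two {V : Type*} [AddCommGroup V] [Module ℂ V] (ket : (ℕ → ℤ) → V) :
    compactAction q 2 ket p = (I * qnum q (p 2 : ℂ)) • ket p := rfl

/-- The cases i = 3 and i ≥ 4 differ only in `leadCoef`. The lowering element is minus the raising
element of the lowered pattern, so a single coefficient controls both directions. -/
theorem compactAction_eq {V : Type*} [AddCommGroup V] [Module ℂ V] {i : ℕ} (hi : 3 ≤ i)
    (ket : (ℕ → ℤ) → V) :
    compactAction q i ket p = (upCoef q i p : ℂ) • ket (shift p (i - 1) 1)
      - (upCoef q i (shift p (i - 1) (-1)) : ℂ) • ket (shift p (i - 1) (-1)) := by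
  rw [compactAction, if_neg (by omega)]
  by_cases h3 : i = 3
  · subst h3
    rw [if_pos rfl]
    simp only [upCoef, leadCoef, if_true]
    norm_num
    rw [shift_same, shift_of_ne p (by norm_num)]
    push_cast
    congr 4
    · ring_nf
    · ring_nf
  · rw [if_neg h3]
    simp only [upCoef, leadCoef, if_neg h3]
    rw [shift_same, shift_of_ne p (i := i) (by omega), shift_of_ne p (i := i - 2) (by omega)]
    push_cast
    congr 2
    · rw [mul_comm]
    · rw [mul_comm]
      congr 2
      ring_nf

theorem leadCoef_pos (hq : 0 < q) (hq1 : q ≠ 1) (hp : IsPattern n p) {i : ℕ} (h3 : 3 ≤ i)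
    (hi : i ≤ n) : 0 < leadCoef q i p := by
  rw [leadCoef]
  split_ifs with h
  · exact Real.sqrt_pos.2 (by positivity)
  · have h1 : p (i - 2) ≤ p (i - 1) := by
      have := hp.le_succ (j := i - 2) (by omega) (by omega)
      rwa [show i - 2 + 1 = i - 1 by omega] at this
    have h2 : -p (i - 1) ≤ p (i - 2) := by
      have := hp.neg_le (j := i - 2) (by omega) (by omega)
      rwa [show i - 2 + 1 = i - 1 by omega] at this
    have h1' : (p (i - 2) : ℝ) ≤ p (i - 1) := by exact_mod_cast h1
    have h2' : -(p (i - 1) : ℝ) ≤ p (i - 2) := by exact_mod_cast h2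
    have h4 : (4 : ℝ) ≤ i := by exact_mod_cast (show 4 ≤ i by omega)
    refine Real.sqrt_pos.2 (div_pos (mul_pos ?_ ?_) (mul_pos ?_ ?_)) <;>
      exact qnumR_pos hq hq1 (by linarith)

/-- Keeps the eigenvalue formula of `Side.separates_lower_step` valid when the raised sequence is
not a pattern. -/
theorem upCoef_eq_zero {i : ℕ} (h : p (i - 1) = p i) : upCoef q i p = 0 := by
  simp [upCoef, h, qnumR_zero]

/-- Both factors increase with the upper entry, the first being positive and the second nonnegative.
This is what lets a matrix element detect m_i. -/
theorem qnumR_mul_strictMono (hq : 0 < q) (hq1 : q ≠ 1) {i : ℕ} (h3 : 3 ≤ i) {b x y : ℤ}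
    (hb : b ≤ x) (hb' : -x ≤ b) (hxy : x < y) :
    qnumR q (x + b + i - 2) * qnumR q (x - b) < qnumR q (y + b + i - 2) * qnumR q (y - b) := by
  have h1 : (b : ℝ) ≤ x := by exact_mod_cast hb
  have h2 : -(x : ℝ) ≤ b := by exact_mod_cast hb'
  have h3' : (3 : ℝ) ≤ i := by exact_mod_cast h3
  have h4 : (x : ℝ) < y := by exact_mod_cast hxy
  exact mul_lt_mul'' (qnumR_strictMono hq hq1 (by linarith))
    (qnumR_strictMono hq hq1 (by linarith)) (qnumR_pos hq hq1 (by linarith)).le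
    (qnumR_nonneg hq hq1 (by linarith))

theorem IsPattern.pred_le (hp : IsPattern n p) {i : ℕ} (h3 : 3 ≤ i) (hi : i ≤ n) :
    p (i - 1) ≤ p i := by
  have := hp.le_succ (j := i - 1) (by omega) (by omega)
  rwa [show i - 1 + 1 = i by omega] at this

theorem IsPattern.neg_le_pred (hp : IsPattern n p) {i : ℕ} (h3 : 3 ≤ i) (hi : i ≤ n) :
    -p i ≤ p (i - 1) := by
  have := hp.neg_le (j := i - 1) (by omega) (by omega)
  rwa [show i - 1 + 1 = i by omega] at this

theorem upCoef_sq (hq : 0 < q) (hq1 : q ≠ 1) (hp : IsPattern n p) {i : ℕ} (h3 : 3 ≤ i)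
    (hi : i ≤ n) : upCoef q i p ^ 2 =
      leadCoef q i p ^ 2 * (qnumR q (p i + p (i - 1) + i - 2) * qnumR q (p i - p (i - 1))) := by
  have h1 : (p (i - 1) : ℝ) ≤ p i := by exact_mod_cast hp.pred_le h3 hi
  have h2 : -(p i : ℝ) ≤ p (i - 1) := by exact_mod_cast hp.neg_le_pred h3 hi
  have h3' : (3 : ℝ) ≤ i := by exact_mod_cast h3
  rw [upCoef, mul_pow, Real.sq_sqrt]
  exact mul_nonneg (qnumR_nonneg hq hq1 (by linarith)) (qnumR_nonneg hq hq1 (by linarith))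

theorem upCoef_ne_zero (hq : 0 < q) (hq1 : q ≠ 1) (hp : IsPattern n p) {i : ℕ} (h3 : 3 ≤ i)
    (hi : i ≤ n) (hlt : p (i - 1) < p i) : upCoef q i p ≠ 0 := by
  have h1 : (p (i - 1) : ℝ) < p i := by exact_mod_cast hlt
  have h2 : -(p i : ℝ) ≤ p (i - 1) := by exact_mod_cast hp.neg_le_pred h3 hi
  have h3' : (3 : ℝ) ≤ i := by exact_mod_cast h3
  refine (mul_pos (leadCoef_pos hq hq1 hp h3 hi) (Real.sqrt_pos.2 (mul_pos ?_ ?_))).ne' <;>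
    exact qnumR_pos hq hq1 (by linarith)

/-- The matrix element `upCoef` determines `m_i` from the entries below it. -/
theorem upCoef_sq_inj (hq : 0 < q) (hq1 : q ≠ 1) {p' : ℕ → ℤ} (hp : IsPattern n p)
    (hp' : IsPattern n p') {i : ℕ} (h3 : 3 ≤ i) (hi : i ≤ n) (heq : ∀ j < i, p j = p' j)
    (h : upCoef q i p ^ 2 = upCoef q i p' ^ 2) : p i = p' i := by
  have hlead : leadCoef q i p = leadCoef q i p' := by
    simp only [leadCoef]
    rw [heq (i - 1) (by omega), heq (i - 2) (by omega)]
    split_ifs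
    · rw [heq 2 (by omega)]
    · rfl
  rw [upCoef_sq hq hq1 hp h3 hi, upCoef_sq hq hq1 hp' h3 hi, hlead] at h
  have h' := mul_left_cancel₀ (pow_pos (leadCoef_pos hq hq1 hp' h3 hi) 2).ne' h
  have a1 := hp.pred_le h3 hi
  have a2 := hp.neg_le_pred h3 hi
  have b1 := hp'.pred_le h3 hi
  have b2 := hp'.neg_le_pred h3 hi
  rw [heq (i - 1) (by omega)] at h' a1 a2
  rcases lt_trichotomy (p i) (p' i) with hlt | heq' | hlt
  · exact absurd h' (qnumR_mul_strictMono hq hq1 h3 a1 a2 hlt).ne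
  · exact heq'
  · exact absurd h' (qnumR_mul_strictMono hq hq1 h3 b1 b2 hlt).ne'

theorem upCoef_congr {p' : ℕ → ℤ} {i : ℕ} (h3 : 3 ≤ i) (heq : ∀ j ≤ i, p j = p' j) :
    upCoef q i p = upCoef q i p' := by
  simp only [upCoef, leadCoef]
  rw [heq i le_rfl, heq (i - 1) (by omega), heq (i - 2) (by omega), heq 2 (by omega)]

theorem KCoef_pos (hq : 0 < q) (hq1 : q ≠ 1) (hn : 2 < n) {m k : ℤ} (h1 : k ≤ m) (h2 : -m ≤ k) :
    0 < KCoef q n m k := by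
  have h1' : (k : ℝ) ≤ m := by exact_mod_cast h1
  have h2' : -(m : ℝ) ≤ k := by exact_mod_cast h2
  have h3 : (2 : ℝ) < n := by exact_mod_cast hn
  refine Real.sqrt_pos.2 (div_pos (mul_pos ?_ ?_) (mul_pos ?_ ?_)) <;>
    exact qnumR_pos hq hq1 (by linarith)

end Coefficients

/-! ### One factor of a double pattern -/

/-- Basis labels `x : X` carrying a pattern `pt x` of size `n` and further data `rest x`, where
every pattern with the same top entry as `pt x` occurs along with `rest x`; `put b p` is the basis
vector with data `b` and pattern `p`. -/
structure Side (n : ℕ) (X : Type*) where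
  pt : X → ℕ → ℤ
  rest : X → ℕ → ℤ
  put : (ℕ → ℤ) → (ℕ → ℤ) → (X →₀ ℂ)
  isPattern : ∀ x, IsPattern n (pt x)
  ext : ∀ x y, pt x = pt y → rest x = rest y → x = y
  put_self : ∀ x, put (rest x) (pt x) = Finsupp.single x 1
  put_cases : ∀ b p, put b p = 0 ∨ ∃ z, pt z = p ∧ rest z = b
  exists_of_isPattern : ∀ x p, IsPattern n p → p n = pt x n → ∃ y, pt y = p ∧ rest y = rest x

namespace Side

variable {n : ℕ} {X : Type*} (σ : Side n X) {q : ℝ}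

/-- The entries `m_2, …, m_i` of the pattern. -/
def lower (i : ℕ) (x : X) : ℕ → ℤ := fun j => if j ≤ i then σ.pt x j else 0

/-- `T i` acts as the `i`-th generator of the compact algebra on the patterns `pt x`. -/
def IsAction (q : ℝ) (T : ℕ → Module.End ℂ (X →₀ ℂ)) : Prop :=
  ∀ i, 2 ≤ i → i ≤ n → ∀ x,
    T i (Finsupp.single x 1) = compactAction q i (σ.put (σ.rest x)) (σ.pt x)

theorem put_apply_of_ne {b p : ℕ → ℤ} {y : X} (h : p ≠ σ.pt y) : σ.put b p y = 0 := by
  classical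
  rcases σ.put_cases b p with h0 | ⟨z, rfl, rfl⟩
  · simp [h0]
  · rw [σ.put_self, Finsupp.single_apply, if_neg]
    rintro rfl
    exact h rfl

theorem filterMap_put {b p : ℕ → ℤ} {P : X → Prop} (h : ∀ z, P z → σ.pt z ≠ p) :
    filterMap P (σ.put b p) = 0 := by
  rcases σ.put_cases b p with h0 | ⟨z, rfl, rfl⟩
  · simp [h0]
  · rw [σ.put_self, filterMap_single_neg fun hz => h z hz rfl]

theorem exists_up (x : X) {j : ℕ} (h2 : 2 ≤ j) (hj : j < n) (hlt : σ.pt x j < σ.pt x (j + 1)) :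
    ∃ y, σ.pt y = shift (σ.pt x) j 1 ∧ σ.rest y = σ.rest x :=
  σ.exists_of_isPattern x _ ((σ.isPattern x).shift_up h2 hj hlt) (shift_of_ne _ (by omega) _)

variable {σ} {T : ℕ → Module.End ℂ (X →₀ ℂ)}

theorem IsAction.apply_single (hT : σ.IsAction q T) {j : ℕ} (h2 : 2 ≤ j) (hj : j < n) (x : X) :
    T (j + 1) (Finsupp.single x 1) =
      (upCoef q (j + 1) (σ.pt x) : ℂ) • σ.put (σ.rest x) (shift (σ.pt x) j 1)
      - (upCoef q (j + 1) (shift (σ.pt x) j (-1)) : ℂ) •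
        σ.put (σ.rest x) (shift (σ.pt x) j (-1)) := by
  rw [hT (j + 1) (by omega) hj, compactAction_eq (by omega), add_tsub_cancel_right]

variable {S : Submodule ℂ (X →₀ ℂ)}

/-- Refines the trivial one-fibre separation by the eigenvalues i[m_2]_q, which are distinct because
[x]_q is strictly increasing on the reals. -/
theorem separates_lower_two (hq : 0 < q) (hq1 : q ≠ 1) (hn : 2 < n) (hT : σ.IsAction q T)
    (hS : ∀ i, 2 ≤ i → i ≤ n → ∀ v ∈ S, T i v ∈ S) : Separates S (σ.lower 2) := by
  have h0 : Separates S (fun _ : X => ()) := by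
    intro v hv a
    convert hv
    ext x
    rw [filterMap_apply, if_pos (Subsingleton.elim _ _)]
  refine h0.refine (fun x => I * qnum q (σ.pt x 2 : ℂ)) (fun t => ⟨T 2, hS 2 le_rfl hn.le, ?_⟩) _ ?_
  · intro x _
    rw [hT 2 le_rfl hn.le, compactAction_two, σ.put_self]
  · intro x y
    have hqn : ∀ z : X, qnum q (σ.pt z 2 : ℂ) = (qnumR q (σ.pt z 2) : ℝ) := fun z => by
      rw [← qnum_ofReal hq]; norm_cast
    constructor
    · intro h
      have : σ.pt x 2 = σ.pt y 2 := by simpa [lower] using congrFun h 2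
      simp [this]
    · rintro ⟨_, h⟩
      have h' := mul_left_cancel₀ I_ne_zero h
      rw [hqn, hqn] at h'
      have h2 : σ.pt x 2 = σ.pt y 2 := by
        have h2 := (qnumR_strictMono hq hq1).injective (Complex.ofReal_injective h')
        exact_mod_cast h2
      ext j
      simp only [lower]
      split_ifs with hj
      · rcases hj.eq_or_lt with rfl | hj
        · exact h2
        · rw [(σ.isPattern x).1 j (Or.inl hj), (σ.isPattern y).1 j (Or.inl hj)]
      · rfl

/-- On the fibre `t` of known lower entries, raise m_i, keep only the raised part, lower it, and
return to `t`. The result is diagonal with eigenvalue `-upCoef ^ 2`, and given the lower entries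
this determines m_{i+1}. -/
theorem separates_lower_step (hq : 0 < q) (hq1 : q ≠ 1) (hT : σ.IsAction q T)
    (hS : ∀ i, 2 ≤ i → i ≤ n → ∀ v ∈ S, T i v ∈ S) {i : ℕ} (h2 : 2 ≤ i) (hi : i < n)
    (hsep : Separates S (σ.lower i)) : Separates S (σ.lower (i + 1)) := by
  refine hsep.refine (fun x => ((-(upCoef q (i + 1) (σ.pt x) ^ 2) : ℝ) : ℂ)) (fun t => ?_) _ ?_
  · refine ⟨filterMap (fun x => σ.lower i x = t) ∘ₗ T (i + 1) ∘ₗ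
      filterMap (fun x => σ.lower i x = shift t i 1) ∘ₗ T (i + 1), fun v hv => ?_, ?_⟩
    · exact hsep _ (hS _ (by omega) hi _ (hsep _ (hS _ (by omega) hi _ hv) _)) _
    · intro x hx
      have hti : t i = σ.pt x i := by rw [← hx]; simp [lower]
      simp only [LinearMap.comp_apply]
      rw [hT.apply_single h2 hi, map_sub, map_smul, map_smul]
      -- The lowered term has i-th entry `t i - 1`, so the projection onto entry `t i + 1` removes
      -- it.
      have hdown : filterMap (fun x => σ.lower i x = shift t i 1)
          (σ.put (σ.rest x) (shift (σ.pt x) i (-1))) = 0 := by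
        refine σ.filterMap_put fun z hz h => ?_
        have := congrFun hz i
        simp only [lower, le_refl, if_true] at this
        rw [h, shift_same, shift_same, hti] at this
        omega
      rw [hdown, smul_zero, sub_zero]
      rcases ((σ.isPattern x).le_succ h2 hi).eq_or_lt with heq | hlt
      · rw [upCoef_eq_zero (i := i + 1) heq]
        simp
      · obtain ⟨y, hy, hyr⟩ := σ.exists_up x h2 hi hlt
        have hput : σ.put (σ.rest x) (shift (σ.pt x) i 1) = Finsupp.single y 1 := by
          rw [← hy, ← hyr, σ.put_self]
        have hly : σ.lower i y = shift t i 1 := by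
          ext j
          rw [lower, hy, ← hx]
          by_cases hj : j = i
          · subst hj; simp [shift_same, lower]
          · rw [shift_of_ne _ hj, shift_of_ne _ hj, lower]
        rw [hput, filterMap_single_pos (p := fun x => σ.lower i x = shift t i 1) hly, map_smul, map_smul,
          hT.apply_single h2 hi, map_sub, map_smul, map_smul]
        rw [hy, hyr, shift_shift, shift_shift, add_neg_cancel, shift_zero, σ.put_self,
          filterMap_single_pos (p := fun x => σ.lower i x = t) hx, σ.filterMap_put, smul_zero, zero_sub, ← neg_smul, smul_smul]
        · congr 1
          push_cast
          ring
        · intro z hz h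
          have := congrFun hz i
          simp only [lower, le_refl, if_true] at this
          rw [h, shift_same, hti] at this
          omega
  · intro x y
    constructor
    · intro h
      have hpt : ∀ j ≤ i + 1, σ.pt x j = σ.pt y j := fun j hj => by
        simpa [lower, hj] using congrFun h j
      refine ⟨?_, by rw [upCoef_congr (by omega) hpt]⟩
      ext j
      simp only [lower]
      split_ifs with hj
      · exact hpt j (by omega)
      · rfl
    · rintro ⟨h, h'⟩
      have hpt : ∀ j < i + 1, σ.pt x j = σ.pt y j := fun j hj => by
        simpa [lower, Nat.lt_succ_iff.1 hj] using congrFun h j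
      have h'' : upCoef q (i + 1) (σ.pt x) ^ 2 = upCoef q (i + 1) (σ.pt y) ^ 2 :=
        neg_injective (by exact_mod_cast h')
      have htop := upCoef_sq_inj hq hq1 (σ.isPattern x) (σ.isPattern y) (by omega) hi hpt h''
      ext j
      simp only [lower]
      split_ifs with hj
      · rcases hj.eq_or_lt with rfl | hj
        · exact htop
        · exact hpt j hj
      · rfl

/-- A subspace invariant under the compact algebra is closed under the projections onto the
vectors with a given pattern. -/
theorem separates_pt (hq : 0 < q) (hq1 : q ≠ 1) (hn : 2 < n) (hT : σ.IsAction q T)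
    (hS : ∀ i, 2 ≤ i → i ≤ n → ∀ v ∈ S, T i v ∈ S) : Separates S σ.pt := by
  have h : ∀ i, 2 ≤ i → i ≤ n → Separates S (σ.lower i) := by
    intro i h2
    induction i, h2 using Nat.le_induction with
    | base => exact fun _ => separates_lower_two hq hq1 hn hT hS
    | succ k hk ih =>
      exact fun hkn => separates_lower_step hq hq1 hT hS hk hkn (ih (by omega))
  have hl : σ.lower n = σ.pt := by
    ext x j
    simp only [lower]
    split_ifs with hj
    · rfl
    · rw [(σ.isPattern x).1 j (by omega)]
  rw [← hl]
  exact h n hn.le le_rfl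

/-- Raising an entry below the top one leads to a label lying in `S` simultaneously. -/
theorem single_mem_iff_up (hq : 0 < q) (hq1 : q ≠ 1) (hT : σ.IsAction q T)
    (hS : ∀ i, 2 ≤ i → i ≤ n → ∀ v ∈ S, T i v ∈ S)
    (hcoord : ∀ v ∈ S, ∀ x, v x ≠ 0 → Finsupp.single x 1 ∈ S) {x y : X} {j : ℕ} (h2 : 2 ≤ j)
    (hj : j < n) (hlt : σ.pt x j < σ.pt x (j + 1)) (hy : σ.pt y = shift (σ.pt x) j 1)
    (hyr : σ.rest y = σ.rest x) : Finsupp.single x 1 ∈ S ↔ Finsupp.single y 1 ∈ S := by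
  have hne := upCoef_ne_zero hq hq1 (σ.isPattern x) (i := j + 1) (by omega) hj hlt
  constructor
  · intro hx
    refine hcoord _ (hS (j + 1) (by omega) hj _ hx) y ?_
    rw [hT.apply_single h2 hj]
    rw [← hyr, ← hy, σ.put_self, Finsupp.sub_apply, Finsupp.smul_apply, Finsupp.smul_apply,
      σ.put_apply_of_ne (y := y)]
    · simpa using hne
    · intro h
      have := congrFun h j
      rw [hy, shift_same, shift_same] at this
      omega
  · intro hx
    refine hcoord _ (hS (j + 1) (by omega) hj _ hx) x ?_
    rw [hT.apply_single h2 hj]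
    rw [hyr, hy, shift_shift, shift_shift, add_neg_cancel, shift_zero, σ.put_self,
      Finsupp.sub_apply, Finsupp.smul_apply, Finsupp.smul_apply, σ.put_apply_of_ne (y := x)]
    · simpa using hne
    · intro h
      have := congrFun h j
      rw [shift_same] at this
      omega

/-- Any entry strictly below its upper neighbour can be raised. The total gap `N` to the top entry
then drops, and the process ends at the constant pattern. -/
theorem single_mem_iff_const (hq : 0 < q) (hq1 : q ≠ 1) (hT : σ.IsAction q T)
    (hS : ∀ i, 2 ≤ i → i ≤ n → ∀ v ∈ S, T i v ∈ S)
    (hcoord : ∀ v ∈ S, ∀ x, v x ≠ 0 → Finsupp.single x 1 ∈ S) {z : X} :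
    ∀ N : ℕ, ∀ x, ∑ j ∈ Finset.Ico 2 n, (σ.pt x n - σ.pt x j).toNat = N →
      σ.rest z = σ.rest x → σ.pt z = constPattern n (σ.pt x n) →
      (Finsupp.single x 1 ∈ S ↔ Finsupp.single z 1 ∈ S) := by
  intro N
  induction N using Nat.strong_induction_on with
  | _ N ih =>
    intro x hN hzr hz
    by_cases h : ∀ j, 2 ≤ j → j < n → σ.pt x (j + 1) ≤ σ.pt x j
    · rw [σ.ext z x (hz.trans ((σ.isPattern x).eq_constPattern h).symm) hzr]
    · push Not at h
      obtain ⟨j, h2, hj, hlt⟩ := h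
      obtain ⟨y, hy, hyr⟩ := σ.exists_up x h2 hj hlt
      rw [single_mem_iff_up hq hq1 hT hS hcoord h2 hj hlt hy hyr]
      have htop : σ.pt y n = σ.pt x n := by rw [hy, shift_of_ne _ (by omega)]
      refine ih _ ?_ y rfl (hzr.trans hyr.symm) (by rw [htop, hz])
      rw [← hN, htop]
      refine Finset.sum_lt_sum (fun k _ => ?_) ⟨j, Finset.mem_Ico.2 ⟨h2, hj⟩, ?_⟩
      · by_cases hk : k = j
        · rw [hy, hk, shift_same]; omega
        · rw [hy, shift_of_ne _ hk]
      · have := (σ.isPattern x).le_top (j := j + 1) (by omega) hj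
        rw [hy, shift_same]
        omega

/-- The labels in `S` depend only on the top entry of the pattern. -/
theorem single_mem_iff (hq : 0 < q) (hq1 : q ≠ 1) (hn : 2 < n) (hT : σ.IsAction q T)
    (hS : ∀ i, 2 ≤ i → i ≤ n → ∀ v ∈ S, T i v ∈ S)
    (hcoord : ∀ v ∈ S, ∀ x, v x ≠ 0 → Finsupp.single x 1 ∈ S) {x y : X}
    (hr : σ.rest x = σ.rest y) (htop : σ.pt x n = σ.pt y n) :
    Finsupp.single x 1 ∈ S ↔ Finsupp.single y 1 ∈ S := by
  have hnn := (σ.isPattern x).nonneg (j := n) hn le_rfl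
  obtain ⟨z, hz, hzr⟩ := σ.exists_of_isPattern x (constPattern n (σ.pt x n))
    (isPattern_constPattern hn hnn) (if_pos ⟨hn.le, le_rfl⟩)
  rw [single_mem_iff_const hq hq1 hT hS hcoord _ x rfl hzr hz,
    single_mem_iff_const hq hq1 hT hS hcoord _ y rfl (hzr.trans hr) (by rw [hz, htop])]

end Side

/-! ### The two factors of the degenerate series -/

section Operators

variable {q : ℝ} {r s : ℕ} {ε : ℤ} {lam : ℂ}

theorem ket_of_isDoublePattern {P : (ℕ → ℤ) × (ℕ → ℤ)} (h : IsDoublePattern r s ε P) :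
    ket r s ε P = Finsupp.single ⟨P, h⟩ 1 := dif_pos h

theorem ket_of_not_isDoublePattern {P : (ℕ → ℤ) × (ℕ → ℤ)} (h : ¬ IsDoublePattern r s ε P) :
    ket r s ε P = 0 := dif_neg h

open Classical in
theorem ket_apply (P : (ℕ → ℤ) × (ℕ → ℤ)) (y : DoublePattern r s ε) :
    ket r s ε P y = if P = y.1 then 1 else 0 := by
  by_cases h : IsDoublePattern r s ε P
  · rw [ket_of_isDoublePattern h, Finsupp.single_apply]
    simp only [Subtype.ext_iff]
  · rw [ket_of_not_isDoublePattern h, if_neg]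
    · rfl
    · rintro rfl
      exact h y.2

theorem ket_cases (P : (ℕ → ℤ) × (ℕ → ℤ)) :
    ket r s ε P = 0 ∨ ∃ z : DoublePattern r s ε, z.1 = P := by
  by_cases h : IsDoublePattern r s ε P
  · exact Or.inr ⟨⟨P, h⟩, rfl⟩
  · exact Or.inl (ket_of_not_isDoublePattern h)

/-- The first pattern of a double pattern. -/
def firstSide (r s : ℕ) (ε : ℤ) : Side r (DoublePattern r s ε) where
  pt x := x.1.1
  rest x := x.1.2
  put b p := ket r s ε (p, b)
  isPattern x := x.2.1
  ext _ _ h1 h2 := Subtype.ext (Prod.ext h1 h2)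
  put_self x := ket_of_isDoublePattern x.2
  put_cases b p := (ket_cases (p, b)).imp_right fun ⟨z, hz⟩ =>
    ⟨z, congrArg Prod.fst hz, congrArg Prod.snd hz⟩
  exists_of_isPattern x p hp htop :=
    ⟨⟨(p, x.1.2), hp, x.2.2.1, by
      simp only [htop]; exact x.2.2.2⟩, rfl, rfl⟩

/-- The second pattern of a double pattern. -/
def secondSide (r s : ℕ) (ε : ℤ) : Side s (DoublePattern r s ε) where
  pt x := x.1.2
  rest x := x.1.1
  put b p := ket r s ε (b, p)
  isPattern x := x.2.2.1
  ext _ _ h1 h2 := Subtype.ext (Prod.ext h2 h1)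
  put_self x := ket_of_isDoublePattern x.2
  put_cases b p := (ket_cases (b, p)).imp_right fun ⟨z, hz⟩ =>
    ⟨z, congrArg Prod.snd hz, congrArg Prod.fst hz⟩
  exists_of_isPattern x p hp htop :=
    ⟨⟨(x.1.1, p), x.2.1, hp, by
      simp only [htop]; exact x.2.2.2⟩, rfl, rfl⟩

theorem op_single (i : ℕ) (x : DoublePattern r s ε) :
    op q r s ε lam i (Finsupp.single x 1) =
      if i ≤ r then compactAction q i (fun p => ket r s ε (p, x.1.2)) x.1.1
      else if i = r + 1 then noncompactAction q r s ε lam x.1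
      else compactAction q (r + s + 2 - i) (fun p => ket r s ε (x.1.1, p)) x.1.2 := by
  rw [op, Finsupp.linearCombination_single, one_smul]

theorem firstSide_isAction : (firstSide r s ε).IsAction q (op q r s ε lam) := by
  intro i _ hi x
  rw [op_single, if_pos hi]
  rfl

theorem secondSide_isAction :
    (secondSide r s ε).IsAction q (fun i => op q r s ε lam (r + s + 2 - i)) := by
  intro i h2 hi x
  simp only
  rw [op_single, if_neg (by omega), if_neg (by omega),
    show r + s + 2 - (r + s + 2 - i) = i by omega]
  rfl

theorem op_succ_single (x : DoublePattern r s ε) :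
    op q r s ε lam (r + 1) (Finsupp.single x 1) = noncompactAction q r s ε lam x.1 := by
  rw [op_single, if_neg (by omega), if_pos rfl]

theorem op_mem_operatorAlgebra {i : ℕ} (h2 : 2 ≤ i) (hi : i ≤ r + s) :
    op q r s ε lam i ∈ operatorAlgebra q r s ε lam :=
  Algebra.subset_adjoin ⟨i, ⟨h2, hi⟩, rfl⟩

theorem mem_of_mem_operatorAlgebra {S : Submodule ℂ (Domain r s ε)}
    (hS : ∀ i, 2 ≤ i → i ≤ r + s → ∀ v ∈ S, op q r s ε lam i v ∈ S)
    {A : Module.End ℂ (Domain r s ε)} (hA : A ∈ operatorAlgebra q r s ε lam) :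
    ∀ v ∈ S, A v ∈ S := by
  induction hA using Algebra.adjoin_induction with
  | mem x hx =>
    obtain ⟨i, hi, rfl⟩ := hx
    exact hS i hi.1 hi.2
  | algebraMap c => exact fun v hv => S.smul_mem c hv
  | add x y _ _ hx hy => exact fun v hv => S.add_mem (hx v hv) (hy v hv)
  | mul x y _ _ hx hy => exact fun v hv => hx _ (hy v hv)

end Operators

/-! ### Irreducibility -/

section Irreducible

variable {q : ℝ} {r s : ℕ} {ε : ℤ} {lam : ℂ} {S : Submodule ℂ (Domain r s ε)}

/-- The generators below and above I_{r+1,r} isolate the first and the second pattern respectively,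
so every basis vector occurring in an element of `S` lies in `S`. -/
theorem single_mem_of_apply_ne_zero (hq : 0 < q) (hq1 : q ≠ 1) (hr : 2 < r) (hs : 2 < s)
    (hS : ∀ i, 2 ≤ i → i ≤ r + s → ∀ v ∈ S, op q r s ε lam i v ∈ S) {v : Domain r s ε}
    (hv : v ∈ S) {x : DoublePattern r s ε} (hx : v x ≠ 0) : Finsupp.single x 1 ∈ S :=
  single_mem_of_separates (g := (firstSide r s ε).pt) (h := (secondSide r s ε).pt)
    (Side.separates_pt hq hq1 hr firstSide_isAction fun i h2 hi => hS i h2 (by omega))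
    (Side.separates_pt hq hq1 hs secondSide_isAction fun i h2 hi => hS _ (by omega) (by omega))
    (fun _ _ h1 h2 => Subtype.ext (Prod.ext h1 h2)) hv hx

theorem isDoublePattern_topPattern (hr : 2 < r) (hs : 2 < s) {m m' : ℤ} (hm : 0 ≤ m)
    (hm' : 0 ≤ m') (h : m + m' ≡ ε [ZMOD 2]) :
    IsDoublePattern r s ε (topPattern r m, topPattern s m') :=
  ⟨isPattern_topPattern hr hm, isPattern_topPattern hs hm', by
    simpa only [topPattern_top] using h⟩

/-- The labels in `S` depend only on the top entries of the two patterns. -/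
theorem single_mem_iff_ket_topPattern (hq : 0 < q) (hq1 : q ≠ 1) (hr : 2 < r) (hs : 2 < s)
    (hS : ∀ i, 2 ≤ i → i ≤ r + s → ∀ v ∈ S, op q r s ε lam i v ∈ S) (x : DoublePattern r s ε) :
    Finsupp.single x 1 ∈ S ↔
      ket r s ε (topPattern r (x.1.1 r), topPattern s (x.1.2 s)) ∈ S := by
  have hcoord : ∀ v ∈ S, ∀ x, v x ≠ 0 → Finsupp.single x 1 ∈ S := fun v hv x hx =>
    single_mem_of_apply_ne_zero hq hq1 hr hs hS hv hx
  have h1 := x.2.1.nonneg hr le_rfl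
  have h2 := x.2.2.1.nonneg hs le_rfl
  let y : DoublePattern r s ε := ⟨(topPattern r (x.1.1 r), x.1.2),
    isPattern_topPattern hr h1, x.2.2.1, by simpa only [topPattern_top] using x.2.2.2⟩
  have hz := isDoublePattern_topPattern hr hs h1 h2 x.2.2.2
  have hxy : Finsupp.single x 1 ∈ S ↔ Finsupp.single y 1 ∈ S :=
    (firstSide r s ε).single_mem_iff hq hq1 hr firstSide_isAction
      (fun i h2 hi => hS i h2 (by omega)) hcoord rfl (topPattern_top r _).symm
  have hyz : Finsupp.single y 1 ∈ S ↔ Finsupp.single ⟨_, hz⟩ 1 ∈ S :=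
    (secondSide r s ε).single_mem_iff hq hq1 hs secondSide_isAction
      (fun i h2 hi => hS _ (by omega) (by omega)) hcoord rfl (topPattern_top s _).symm
  rw [hxy, hyz, ket_of_isDoublePattern]

theorem topPattern_inj {n : ℕ} {m m' : ℤ} : topPattern n m = topPattern n m' ↔ m = m' :=
  ⟨fun h => by simpa only [topPattern_top] using congrFun h n, fun h => by rw [h]⟩

-- The representatives |m, 0, …, 0⟩ are stable under changes of m, and k = 0 lets m be lowered as
-- long as m ≥ 1.
open Classical in
theorem noncompactAction_topPattern_apply (hr : 2 < r) (hs : 2 < s) (m m' a b : ℤ)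
    (h : IsDoublePattern r s ε (topPattern r a, topPattern s b)) :
    noncompactAction q r s ε lam (topPattern r m, topPattern s m') ⟨_, h⟩ =
      ((KCoef q r m 0 * KCoef q s m' 0 : ℝ) : ℂ) * qnum q (lam + m + m') *
          (if m + 1 = a ∧ m' + 1 = b then 1 else 0)
      - ((KCoef q r m 0 * KCoef q s (m' - 1 : ℤ) 0 : ℝ) : ℂ) * qnum q (lam + m - m' - s + 2) *
          (if m + 1 = a ∧ m' - 1 = b then 1 else 0)
      + ((KCoef q r (m - 1 : ℤ) 0 * KCoef q s m' 0 : ℝ) : ℂ) * qnum q (lam - m + m' - r + 2) *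
          (if m - 1 = a ∧ m' + 1 = b then 1 else 0)
      - ((KCoef q r (m - 1 : ℤ) 0 * KCoef q s (m' - 1 : ℤ) 0 : ℝ) : ℂ) *
          qnum q (lam - m - m' - r - s + 4) *
          (if m - 1 = a ∧ m' - 1 = b then 1 else 0) := by
  simp only [noncompactAction, topPattern_top, topPattern_pred hr, topPattern_pred hs,
    shift_topPattern, Finsupp.sub_apply, Finsupp.add_apply, Finsupp.smul_apply, ket_apply,
    Prod.mk.injEq, topPattern_inj, smul_eq_mul, Int.cast_zero, Int.cast_sub, Int.cast_one,
    ← sub_eq_add_neg]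

/-- Slide along the antidiagonal to (a + b, 0), then descend by two through (a + 2, 0), (a + 1, 1),
(a, 0). -/
theorem iff_of_diagonal_moves {C : ℕ → ℕ → Prop}
    (h1 : ∀ a b, C a b ↔ C (a + 1) (b + 1)) (h2 : ∀ a b, C (a + 1) b ↔ C a (b + 1)) (a b : ℕ) :
    C a b ↔ C ((a + b) % 2) 0 := by
  have hsum : ∀ b a, C a b ↔ C (a + b) 0 := by
    intro b
    induction b with
    | zero => exact fun a => Iff.rfl
    | succ b ih => exact fun a => by rw [← h2, ih]; ring_nf
  have htwo : ∀ a, C (a + 2) 0 ↔ C a 0 := by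
    intro a
    rw [h2 (a + 1) 0, ← h1]
  have hmod : ∀ k a, C (a + 2 * k) 0 ↔ C a 0 := by
    intro k
    induction k with
    | zero => exact fun a => Iff.rfl
    | succ k ih => exact fun a => by rw [mul_add, mul_one, ← add_assoc, htwo, ih]
  rw [hsum, ← hmod ((a + b) / 2) ((a + b) % 2), Nat.mod_add_div]

open Classical in
theorem dense_range_toHilbert : closure (Set.range (toHilbert r s ε)) = Set.univ := by
  refine Set.eq_univ_of_forall fun f => ?_
  have : Fact ((1 : ENNReal) ≤ 2) := ⟨by norm_num⟩
  refine mem_closure_of_tendsto (lp.hasSum_single (by norm_num) f)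
    (Filter.Eventually.of_forall fun t => ⟨∑ x ∈ t, Finsupp.single x (f x), ?_⟩)
  rw [map_sum]
  refine Finset.sum_congr rfl fun x _ => ?_
  rw [toHilbert, Finsupp.linearCombination_single, ← lp.single_smul, smul_eq_mul, mul_one]

/-- `T_{ελ}` is irreducible if no transition between admissible labels is forbidden. -/
theorem isIrreducible_of_qnum_ne_zero (hq : 0 < q) (hq1 : q ≠ 1) (hr : 2 < r) (hs : 2 < s)
    (hε : ε = 0 ∨ ε = 1)
    (h1 : ∀ m m' : ℤ, 0 ≤ m → 0 ≤ m' → m + m' ≡ ε [ZMOD 2] → qnum q (lam + m + m') ≠ 0)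
    (h2 : ∀ m m' : ℤ, m + m' ≡ ε [ZMOD 2] → qnum q (lam + m - m' - s + 2) ≠ 0)
    (h3 : ∀ m m' : ℤ, m + m' ≡ ε [ZMOD 2] → qnum q (lam - m + m' - r + 2) ≠ 0)
    (h4 : ∀ m m' : ℤ, 1 ≤ m → 1 ≤ m' → m + m' ≡ ε [ZMOD 2] →
      qnum q (lam - m - m' - r - s + 4) ≠ 0) :
    IsIrreducible q r s ε lam := by
  intro S hA hne
  have hS : ∀ i, 2 ≤ i → i ≤ r + s → ∀ v ∈ S, op q r s ε lam i v ∈ S := fun i hi hi' =>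
    hA _ (op_mem_operatorAlgebra hi hi')
  have hK : ∀ {n : ℕ} (_ : 2 < n) {m : ℤ} (_ : 0 ≤ m), KCoef q n m 0 ≠ 0 := by
    intro n hn m hm
    have := KCoef_pos hq hq1 hn (k := 0) hm (by omega)
    rw [Int.cast_zero] at this
    exact this.ne'
  have hmove : ∀ m m' a b : ℤ, 0 ≤ m → 0 ≤ m' → 0 ≤ a → 0 ≤ b → m + m' ≡ ε [ZMOD 2] →
      (a = m + 1 ∨ a = m - 1) → (b = m' + 1 ∨ b = m' - 1) →
      ket r s ε (topPattern r m, topPattern s m') ∈ S →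
      ket r s ε (topPattern r a, topPattern s b) ∈ S := by
    intro m m' a b hm hm' ha hb hpar hma hmb hmem
    have hpar' : a + b ≡ ε [ZMOD 2] := by
      unfold Int.ModEq at hpar ⊢
      omega
    have hx := isDoublePattern_topPattern hr hs hm hm' hpar
    have hy := isDoublePattern_topPattern hr hs ha hb hpar'
    rw [ket_of_isDoublePattern hx] at hmem
    rw [ket_of_isDoublePattern hy]
    refine single_mem_of_apply_ne_zero hq hq1 hr hs hS
      (hS (r + 1) (by omega) (by omega) _ hmem) ?_
    rw [op_succ_single, noncompactAction_topPattern_apply hr hs]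
    rcases hma with rfl | rfl <;> rcases hmb with rfl | rfl
    · have e1 : ¬ m' - 1 = m' + 1 := by omega
      have e2 : ¬ m - 1 = m + 1 := by omega
      simpa [e1, e2] using ⟨⟨hK hr hm, hK hs hm'⟩, h1 m m' hm hm' hpar⟩
    · have e1 : ¬ m' + 1 = m' - 1 := by omega
      have k2 := hK hs hb
      have e2 : ¬ m - 1 = m + 1 := by omega
      push_cast at k2
      simpa [e1, e2] using ⟨⟨hK hr hm, k2⟩, h2 m m' hpar⟩
    · have e1 : ¬ m' - 1 = m' + 1 := by omega
      have e2 : ¬ m + 1 = m - 1 := by omega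
      -- The factor K_{m-1} is nonzero because the target entry m - 1 is itself nonnegative.
      have k1 := hK hr ha
      push_cast at k1
      simpa [e1, e2] using ⟨⟨k1, hK hs hm'⟩, h3 m m' hpar⟩
    · have e1 : ¬ m' + 1 = m' - 1 := by omega
      have k2 := hK hs hb
      have e2 : ¬ m + 1 = m - 1 := by omega
      have k1 := hK hr ha
      push_cast at k1 k2
      simpa [e1, e2] using ⟨⟨k1, k2⟩, h4 m m' (by omega) (by omega) hpar⟩
  -- Written as an implication so that the equivalences hold on all of ℕ × ℕ, vacuously off the
  -- parity class.
  let C : ℕ → ℕ → Prop := fun a b =>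
    ((a : ℤ) + b ≡ ε [ZMOD 2]) → ket r s ε (topPattern r a, topPattern s b) ∈ S
  have hC : ∀ a b, C a b ↔ C ((a + b) % 2) 0 := by
    refine iff_of_diagonal_moves (fun a b => ?_) (fun a b => ?_)
    all_goals
      constructor <;> intro h hp <;>
      refine hmove _ _ _ _ ?_ ?_ ?_ ?_ ?_ ?_ ?_ (h ?_) <;>
      (try unfold Int.ModEq at *) <;> push_cast at * <;> omega
  have hpar : ∀ a b : ℕ, (a : ℤ) + b ≡ ε [ZMOD 2] → ((a + b) % 2 : ℕ) = ε.toNat := by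
    intro a b h
    unfold Int.ModEq at h
    omega
  obtain ⟨v, hv, hv0⟩ := S.ne_bot_iff.1 hne
  obtain ⟨x, hx⟩ := Finsupp.ne_iff.1 hv0
  have hbase : C ε.toNat 0 := by
    have hmem := (single_mem_iff_ket_topPattern hq hq1 hr hs hS x).1
      (single_mem_of_apply_ne_zero hq hq1 hr hs hS hv hx)
    obtain ⟨a, ha⟩ := Int.eq_ofNat_of_zero_le (x.2.1.nonneg hr le_rfl)
    obtain ⟨b, hb⟩ := Int.eq_ofNat_of_zero_le (x.2.2.1.nonneg hs le_rfl)
    have hp := x.2.2.2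
    rw [ha, hb] at hmem hp
    rw [← hpar a b hp]
    exact (hC a b).1 fun _ => hmem
  have htop : S = ⊤ := by
    refine (Submodule.eq_top_iff'.2 fun w => ?_)
    rw [← Finsupp.sum_single w]
    refine Submodule.sum_mem _ fun y _ => ?_
    have hy : Finsupp.single y (1 : ℂ) ∈ S := by
      rw [single_mem_iff_ket_topPattern hq hq1 hr hs hS]
      obtain ⟨a, ha⟩ := Int.eq_ofNat_of_zero_le (y.2.1.nonneg hr le_rfl)
      obtain ⟨b, hb⟩ := Int.eq_ofNat_of_zero_le (y.2.2.1.nonneg hs le_rfl)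
      have hp := y.2.2.2
      rw [ha, hb] at hp ⊢
      exact (hC a b).2 (by rwa [hpar a b hp]) hp
    simpa using S.smul_mem (w y) hy
  rw [htop, Submodule.top_coe, Set.image_univ, dense_range_toHilbert]

end Irreducible

/-! ### Reducibility -/

section Reducible

variable {q : ℝ} {r s : ℕ} {ε : ℤ} {lam : ℂ}

theorem ket_mem_supported {C : ℤ → ℤ → Prop} {P : (ℕ → ℤ) × (ℕ → ℤ)} (h : C (P.1 r) (P.2 s)) :
    ket r s ε P ∈ Finsupp.supported ℂ ℂ {P : DoublePattern r s ε | C (P.1.1 r) (P.1.2 s)} := by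
  by_cases hP : IsDoublePattern r s ε P
  · rw [ket_of_isDoublePattern hP]
    exact Finsupp.single_mem_supported _ _ h
  · rw [ket_of_not_isDoublePattern hP]
    exact Submodule.zero_mem _

/-- I_{i,i-1} alters at most the entry m_{i-1}, so the entries from m_i up to the top one stay
fixed. -/
theorem compactAction_mem {V : Type*} [AddCommGroup V] [Module ℂ V] {S : Submodule ℂ V} {i : ℕ}
    (h2 : 2 ≤ i) {k : (ℕ → ℤ) → V} {p : ℕ → ℤ} (h : ∀ p' : ℕ → ℤ, (∀ j ≥ i, p' j = p j) → k p' ∈ S) :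
    compactAction q i k p ∈ S := by
  rcases h2.eq_or_lt with rfl | h3
  · rw [compactAction_two]
    exact S.smul_mem _ (h p fun _ _ => rfl)
  · rw [compactAction_eq h3]
    exact S.sub_mem (S.smul_mem _ (h _ fun j hj => shift_of_ne _ (by omega) _))
      (S.smul_mem _ (h _ fun j hj => shift_of_ne _ (by omega) _))

open Classical in
/-- If a nonempty proper set `C` of pairs of top entries cannot be left, then `T_{ελ}` is
reducible. -/
theorem not_isIrreducible (hr : 2 < r) (hs : 2 < s) (l : ℤ) (C : ℤ → ℤ → Prop)
    (hin : ∃ m m' : ℤ, 0 ≤ m ∧ 0 ≤ m' ∧ m + m' ≡ ε [ZMOD 2] ∧ C m m')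
    (hout : ∃ m m' : ℤ, 0 ≤ m ∧ 0 ≤ m' ∧ m + m' ≡ ε [ZMOD 2] ∧ ¬ C m m')
    (hstep : ∀ m m' : ℤ, m + m' ≡ ε [ZMOD 2] → C m m' →
      (C (m + 1) (m' + 1) ∨ l + m + m' = 0) ∧
      (C (m + 1) (m' - 1) ∨ l + m - m' - s + 2 = 0) ∧
      (C (m - 1) (m' + 1) ∨ l - m + m' - r + 2 = 0) ∧
      (C (m - 1) (m' - 1) ∨ l - m - m' - r - s + 4 = 0)) :
    ¬ IsIrreducible q r s ε l := by
  intro hirr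
  set S := Finsupp.supported ℂ ℂ {P : DoublePattern r s ε | C (P.1.1 r) (P.1.2 s)} with hSdef
  have hS : ∀ i, 2 ≤ i → i ≤ r + s → ∀ v ∈ S, op q r s ε l i v ∈ S := by
    intro i h2 hi v hv
    rw [op, Finsupp.linearCombination_apply]
    refine Submodule.sum_mem _ fun x hx => S.smul_mem _ ?_
    have hCx : C (x.1.1 r) (x.1.2 s) := hv hx
    split_ifs with hir hir'
    · refine compactAction_mem h2 fun p' hp' => ket_mem_supported ?_
      simpa only [hp' r hir] using hCx
    · obtain ⟨k1, k2, k3, k4⟩ := hstep _ _ x.2.2.2 hCx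
      -- Each of the four terms either has its target in `C` or carries a vanishing q-number.
      have key : ∀ (c z : ℂ) (a b : ℤ), (C (x.1.1 r + a) (x.1.2 s + b) ∨ z = 0) →
          (c * qnum q z) • ket r s ε (shift x.1.1 r a, shift x.1.2 s b) ∈ S := by
        rintro c z a b (h | rfl)
        · refine S.smul_mem _ (ket_mem_supported ?_)
          simpa only [shift_same] using h
        · rw [qnum_zero, mul_zero, zero_smul]
          exact S.zero_mem
      refine S.sub_mem (S.add_mem (S.sub_mem (key _ _ _ _ (k1.imp_right fun h => ?_))
        (key _ _ _ _ (k2.imp_right fun h => ?_))) (key _ _ _ _ (k3.imp_right fun h => ?_)))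
        (key _ _ _ _ (k4.imp_right fun h => ?_)) <;>
        simpa using congrArg (Int.cast : ℤ → ℂ) h
    · refine compactAction_mem (by omega) fun p' hp' => ket_mem_supported ?_
      simpa only [hp' s (by omega)] using hCx
  obtain ⟨m, m', hm, hm', hpar, hC⟩ := hin
  obtain ⟨n, n', hn, hn', hpar', hC'⟩ := hout
  have hx := isDoublePattern_topPattern hr hs hm hm' hpar
  have hy := isDoublePattern_topPattern hr hs hn hn' hpar'
  have hne : S ≠ ⊥ := by
    refine S.ne_bot_iff.2 ⟨Finsupp.single ⟨_, hx⟩ 1, Finsupp.single_mem_supported _ _ ?_, by simp⟩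
    simpa only [Set.mem_ofPred_eq, topPattern_top] using hC
  have hdense := hirr S (fun A hA => mem_of_mem_operatorAlgebra hS hA) hne
  have : Fact ((1 : ENNReal) ≤ 2) := ⟨by norm_num⟩
  set y : DoublePattern r s ε := ⟨_, hy⟩ with hydef
  -- The coordinate at an excluded label `y` is continuous and vanishes on `S`, so the closure of
  -- `S` misses the basis vector at `y`.
  have hclosed : IsClosed {f : HilbertSp r s ε | f y = 0} :=
    isClosed_eq ((continuous_apply y).comp (lp.uniformContinuous_coe).continuous) continuous_const
  have hsub : toHilbert r s ε '' (S : Set (Domain r s ε)) ⊆ {f | f y = 0} := by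
    rintro _ ⟨v, hv, rfl⟩
    rw [Set.mem_ofPred_eq, toHilbert, Finsupp.linearCombination_apply, Finsupp.sum,
      lp.coeFn_sum, Finset.sum_apply]
    refine Finset.sum_eq_zero fun x hx => ?_
    have hxy : y ≠ x := by
      rintro rfl
      have hCy : C (topPattern r n r) (topPattern s n' s) := hv hx
      rw [topPattern_top, topPattern_top] at hCy
      exact hC' hCy
    rw [lp.coeFn_smul, Pi.smul_apply, lp.single_apply_ne _ _ _ hxy, smul_zero]
  have hmem : (lp.single 2 y (1 : ℂ) : HilbertSp r s ε) ∈ {f : HilbertSp r s ε | f y = 0} :=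
    hclosed.closure_subset_iff.2 hsub (hdense ▸ Set.mem_univ _)
  rw [Set.mem_ofPred_eq, lp.single_apply_self] at hmem
  exact one_ne_zero hmem

end Reducible

end

end DegenerateSeries

/-! ### Forbidden transitions as congruences and inequalities for an integer λ -/

namespace DegenerateSeries

section Criterion

variable {q : ℝ} {r s : ℕ} {ε : ℤ} {lam : ℂ}

/-- The representation is irreducible exactly if none of the four kinds of transitions is
forbidden at some admissible label. -/
theorem isIrreducible_iff (hq : 0 < q) (hq1 : q ≠ 1) (hr : 2 < r) (hs : 2 < s)
    (hε : ε = 0 ∨ ε = 1) (hlam : 0 ≤ lam.im) (hlam' : lam.im < 2 * Real.pi / |Real.log q|) :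
    IsIrreducible q r s ε lam ↔ ∀ l : ℤ, lam = l →
      ¬ ((l - ε) % 2 = 0 ∧ l ≤ 0) ∧ ¬ (l - ε - s) % 2 = 0 ∧ ¬ (l - ε - r) % 2 = 0 ∧
      ¬ ((l - ε - r - s) % 2 = 0 ∧ (r : ℤ) + s - 2 ≤ l) := by
  constructor
  · rintro hirr l rfl
    by_contra hcon
    have hcases : ((l - ε) % 2 = 0 ∧ l ≤ 0) ∨ (l - ε - s) % 2 = 0 ∨ (l - ε - r) % 2 = 0 ∨
        ((l - ε - r - s) % 2 = 0 ∧ (r : ℤ) + s - 2 ≤ l) := by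
      by_contra h
      push Not at h
      exact hcon ⟨fun h' => absurd h'.2 (h.1 h'.1).not_ge, h.2.1, h.2.2.1,
        fun h' => absurd h'.2 (h.2.2.2 h'.1).not_ge⟩
    refine absurd hirr ?_
    rcases hcases with ⟨hp, hl⟩ | hp | hp | ⟨hp, hl⟩
    -- A move changes m + m' by 0 or ±2, so by parity the region can be left only from the line m +
    -- m' = -l, where [l + m + m']_q = 0. The other three regions work the same way.
    · refine not_isIrreducible hr hs l (fun m m' => m + m' ≤ -l)
        ⟨-l, 0, by omega, le_rfl, by unfold Int.ModEq; omega, by omega⟩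
        ⟨-l + 2, 0, by omega, le_rfl, by unfold Int.ModEq; omega, by omega⟩ ?_
      intro m m' hm hC
      unfold Int.ModEq at hm
      omega
    -- The difference m - m' is unbounded in both directions, so no inequality on `l` is needed; the
    -- witnesses are far out and have the parity of `ε`.
    · refine not_isIrreducible hr hs l (fun m m' => m - m' ≤ s - 2 - l)
        ⟨0, 2 * |l| + ε, le_rfl, by have := abs_nonneg l; omega,
          by unfold Int.ModEq; omega, by have := le_abs_self l; have := abs_nonneg l; omega⟩
        ⟨2 * |l| + 2 * s + ε, 0, by have := abs_nonneg l; omega, le_rfl,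
          by unfold Int.ModEq; omega, by have := neg_abs_le l; have := abs_nonneg l; omega⟩ ?_
      intro m m' hm hC
      unfold Int.ModEq at hm
      omega
    · refine not_isIrreducible hr hs l (fun m m' => m' - m ≤ r - 2 - l)
        ⟨2 * |l| + ε, 0, by have := abs_nonneg l; omega, le_rfl,
          by unfold Int.ModEq; omega, by have := le_abs_self l; have := abs_nonneg l; omega⟩
        ⟨0, 2 * |l| + 2 * r + ε, le_rfl, by have := abs_nonneg l; omega,
          by unfold Int.ModEq; omega, by have := neg_abs_le l; have := abs_nonneg l; omega⟩ ?_
      intro m m' hm hC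
      unfold Int.ModEq at hm
      omega
    -- The bound on `l` makes l - r - s + 2 nonnegative, so an excluded label exists.
    · refine not_isIrreducible hr hs l (fun m m' => l - r - s + 4 ≤ m + m')
        ⟨l - r - s + 4, 0, by omega, le_rfl, by unfold Int.ModEq; omega, by omega⟩
        ⟨l - r - s + 2, 0, by omega, le_rfl, by unfold Int.ModEq; omega, by omega⟩ ?_
      intro m m' hm hC
      unfold Int.ModEq at hm
      omega
  · intro H
    have key : ∀ a : ℤ, qnum q (lam + a) = 0 → lam = ((-a : ℤ) : ℂ) := fun a h => by
      have := eq_zero_of_qnum_eq_zero hq hq1 (z := lam + a) (by simpa using hlam)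
        (by simpa using hlam') h
      push_cast
      exact eq_neg_of_add_eq_zero_left this
    refine isIrreducible_of_qnum_ne_zero hq hq1 hr hs hε (fun m m' hm hm' hp h => ?_)
      (fun m m' hp h => ?_) (fun m m' hp h => ?_) (fun m m' hm hm' hp h => ?_)
    · have := H _ (key (m + m') (by push_cast; rw [← h]; ring_nf))
      unfold Int.ModEq at hp
      omega
    · have := H _ (key (m - m' - s + 2) (by push_cast; rw [← h]; ring_nf))
      unfold Int.ModEq at hp
      omega
    · have := H _ (key (-m + m' - r + 2) (by push_cast; rw [← h]; ring_nf))
      unfold Int.ModEq at hp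
      omega
    -- Here l = m + m' + r + s - 4, and m, m' ≥ 1 give l ≥ r + s - 2.
    · have := H _ (key (-m - m' - r - s + 4) (by push_cast; rw [← h]; ring_nf))
      unfold Int.ModEq at hp
      omega

end Criterion

end DegenerateSeries

theorem theorem1 (q : ℝ) (hq : 0 < q) (hq1 : q ≠ 1) (r s : ℕ) (hr : 2 < r) (hs : 2 < s)
    (ε : ℤ) (hε : ε = 0 ∨ ε = 1) (lam : ℂ)
    (hlam : 0 ≤ lam.im) (hlam' : lam.im < 2 * Real.pi / |Real.log q|) :
    (Even r → Even s →
      (DegenerateSeries.IsIrreducible q r s ε lam ↔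
        ¬ ∃ l : ℤ, lam = (l : ℂ) ∧ l ≡ ε [ZMOD 2])) ∧
    ((Even r ∧ Odd s) ∨ (Odd r ∧ Even s) →
      (DegenerateSeries.IsIrreducible q r s ε lam ↔ ¬ ∃ l : ℤ, lam = (l : ℂ))) ∧
    (Odd r → Odd s →
      (DegenerateSeries.IsIrreducible q r s ε lam ↔
        (¬ ∃ l : ℤ, lam = (l : ℂ)) ∨
          ∃ l : ℤ, lam = (l : ℂ) ∧ l ≡ ε [ZMOD 2] ∧ 0 < l ∧ l < (r : ℤ) + (s : ℤ) - 2)) := by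
  rw [DegenerateSeries.isIrreducible_iff hq hq1 hr hs hε hlam hlam']
  by_cases hint : ∃ l : ℤ, lam = (l : ℂ)
  · obtain ⟨l, rfl⟩ := hint
    simp only [Int.cast_inj, forall_eq', exists_eq', exists_eq_left', not_true, false_or,
      Nat.even_iff, Nat.odd_iff, Int.ModEq]
    -- For r, s even all four congruences read l ≡ ε; for mixed parity one of the middle two always
    -- holds. For r, s odd the middle two exclude l ≢ ε, and the outer two exclude l ≤ 0 and l ≥ r +
    -- s - 2 when l ≡ ε.
    refine ⟨fun h2 h3 => ⟨fun h => ?_, fun h => ⟨?_, ?_, ?_, ?_⟩⟩,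
      fun h2 => ⟨fun h => ?_, False.elim⟩,
      fun h2 h3 => ⟨fun h => ⟨?_, ?_, ?_⟩, fun h => ⟨?_, ?_, ?_, ?_⟩⟩⟩ <;> omega
  · have h1 : ∀ l : ℤ, lam ≠ l := fun l h => hint ⟨l, h⟩
    simp [h1]
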